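/- Let $q$ be a complex number with $|q|<1$. Write $(a;q)_n=\prod_{j=0}^{n-1}(1-aq^{j})$, $(a;q)_\infty=\prod_{j\ge 0}(1-aq^{j})$, $(q)_n=(q;q)_n$, $(q)_\infty=(q;q)_\infty$, $(a_1,a_2,a_3;q)_\infty=(a_1;q)_\infty(a_2;q)_\infty(a_3;q)_\infty$, and ${N\brack k}=\frac{(q)_N}{(q)_k(q)_{N-k}}$ for integers $0\le k\le N$. Then $$\sum_{n=0}^{\infty}\ \sum_{m=-\lfloor \frac{n+1}{2}\rfloor}^{\lfloor \frac n2\rfloor}\frac{(-1)^m\,q^{\,n(n+1)+m(5m+3)/2}}{(q)_{2n+1}}{2n+1\brack n-2m}=\frac{(q^3,q^{10},q^{13};q^{13})_\infty}{(q)_\infty},$$ where the series over $n$ (of finite inner sums over $m$) converges absolutely. -/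

import Mathlib

/-- The finite `q`-shifted factorial `(a; q)_n = ∏_{j=0}^{n-1} (1 - a q^j)`. -/
noncomputable def qPoch (a q : ℂ) (n : ℕ) : ℂ :=
  ∏ j ∈ Finset.range n, (1 - a * q ^ j)

/-- The infinite `q`-shifted factorial `(a; q)_∞ = ∏_{j ≥ 0} (1 - a q^j)`. -/
noncomputable def qPochInf (a q : ℂ) : ℂ :=
  ∏' j : ℕ, (1 - a * q ^ j)

/-- For `|q| < 1` the product defining `(a; q)_∞` converges. -/
theorem multipliable_qPochInf (a : ℂ) {q : ℂ} (hq : ‖q‖ < 1) :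
    Multipliable (fun j : ℕ => 1 - a * q ^ j) := by
  have h : Summable (fun j : ℕ => ‖-(a * q ^ j)‖) := by
    simpa [norm_mul, norm_pow] using
      (summable_geometric_of_lt_one (norm_nonneg q) hq).mul_left ‖a‖
  simpa [sub_eq_add_neg] using multipliable_one_add_of_summable h

/-- The Gaussian binomial coefficient `[n brack k]_q = (q; q)_n / ((q; q)_k (q; q)_{n-k})`
for `0 ≤ k ≤ n`, and `0` for all other integers `k`. -/
noncomputable def qBinom (q : ℂ) (n : ℕ) (k : ℤ) : ℂ :=
  if 0 ≤ k ∧ k ≤ n then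
    qPoch q q n / (qPoch q q k.toNat * qPoch q q (n - k.toNat))
  else 0

open Filter Topology

/-! Extend `1/(q)_n` by zero to negative `n`. The summand becomes `(-1)^m q^{n(n+1)+m(5m+3)/2} /
((q)_{n-2m} (q)_{n+1+2m})` on all of `ℤ × ℤ`, an absolutely convergent family, so the order of
summation may be exchanged. For fixed `m` put `k = n - 2m`: then `n(n+1) = k(k+4m+1) + 4m² + 2m`,
and the sum over `k` is a Durfee rectangle series (`hasSum_durfee`), equal to `1/(q)_∞` for every
`m`. What remains is `∑ (-1)^m q^{13m(m-1)/2+10m}`, which `hasSum_triple_product` evaluates with `Q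
= q^13`, `z = q^10`, `w = q^3`. Both classical identities are limits, by dominated convergence, of
finite versions proved by induction on `N`. -/

theorem HasSum.of_eq {β : Type*} {f g : β → ℂ} {a b : ℂ} (h : HasSum f a) (hf : ∀ x, g x = f x)
    (ha : b = a) : HasSum g b := by
  rwa [funext hf, ha]

/-! ### Shifted factorials and their reciprocals -/

theorem qPoch_succ (a q : ℂ) (n : ℕ) : qPoch a q (n + 1) = qPoch a q n * (1 - a * q ^ n) :=
  Finset.prod_range_succ _ _

theorem qPoch_self_ne_zero {q : ℂ} (hq : ‖q‖ < 1) (n : ℕ) : qPoch q q n ≠ 0 := by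
  refine Finset.prod_ne_zero_iff.mpr fun j _ h => ?_
  have h1 : q ^ (j + 1) = 1 := by rw [pow_succ']; linear_combination -h
  have h2 := congrArg norm h1
  rw [norm_pow, norm_one] at h2
  exact absurd h2 (pow_lt_one₀ (norm_nonneg q) hq (Nat.succ_ne_zero j)).ne

theorem tendsto_qPoch (a : ℂ) {q : ℂ} (hq : ‖q‖ < 1) :
    Tendsto (qPoch a q) atTop (𝓝 (qPochInf a q)) :=
  (multipliable_qPochInf a hq).hasProd.tendsto_prod_nat

theorem qPochInf_self_ne_zero {q : ℂ} (hq : ‖q‖ < 1) : qPochInf q q ≠ 0 := by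
  have h : Summable (fun j : ℕ => ‖-(q * q ^ j)‖) := by
    simpa [norm_mul, norm_pow] using
      (summable_geometric_of_lt_one (norm_nonneg q) hq).mul_left ‖q‖
  have := tprod_one_add_ne_zero_of_summable (f := fun j : ℕ => -(q * q ^ j)) (fun j => ?_) h
  · simpa [qPochInf, sub_eq_add_neg] using this
  · intro h0
    apply qPoch_self_ne_zero hq (j + 1)
    rw [qPoch_succ, sub_eq_add_neg, h0, mul_zero]

/-- The reciprocal `1 / (q; q)_n`, extended by zero to negative `n`. -/
noncomputable def qPochRecip (q : ℂ) (n : ℤ) : ℂ :=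
  if 0 ≤ n then (qPoch q q n.toNat)⁻¹ else 0

theorem qPochRecip_natCast (q : ℂ) (n : ℕ) : qPochRecip q n = (qPoch q q n)⁻¹ := by
  simp [qPochRecip]

theorem qPochRecip_of_neg (q : ℂ) {n : ℤ} (hn : n < 0) : qPochRecip q n = 0 :=
  if_neg (not_le.mpr hn)

theorem qPochRecip_zero (q : ℂ) : qPochRecip q 0 = 1 := by
  simp [qPochRecip, qPoch]

/-- The zero extension keeps the recurrence valid on all of `ℤ`: at `n = 0` the factor `1 - q^0`
vanishes. The inductions below therefore need no boundary cases in the summation index. -/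
theorem qPochRecip_sub_one {q : ℂ} (hq : ‖q‖ < 1) (n : ℤ) :
    qPochRecip q (n - 1) = (1 - q ^ n) * qPochRecip q n := by
  rcases lt_trichotomy n 0 with hn | rfl | hn
  · rw [qPochRecip_of_neg q hn, qPochRecip_of_neg q (by omega), mul_zero]
  · rw [qPochRecip_of_neg q (by omega), zpow_zero, sub_self, zero_mul]
  · obtain ⟨k, rfl⟩ : ∃ k : ℕ, n = (k + 1 : ℕ) := ⟨(n - 1).toNat, by omega⟩
    have h1 : ((k + 1 : ℕ) : ℤ) - 1 = k := by push_cast; ring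
    have h2 := qPoch_self_ne_zero hq (k + 1)
    have h3 := qPoch_self_ne_zero hq k
    rw [h1, qPochRecip_natCast, qPochRecip_natCast, zpow_natCast, eq_mul_inv_iff_mul_eq₀ h2,
      qPoch_succ, pow_succ']
    field_simp

theorem qPochRecip_add_one_mul {q : ℂ} (hq : ‖q‖ < 1) (n : ℤ) :
    (1 - q ^ (n + 1)) * qPochRecip q (n + 1) = qPochRecip q n := by
  rw [← qPochRecip_sub_one hq, add_sub_cancel_right]

theorem tendsto_qPochRecip {q : ℂ} (hq : ‖q‖ < 1) :
    Tendsto (qPochRecip q) atTop (𝓝 (qPochInf q q)⁻¹) := by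
  rw [← Nat.map_cast_int_atTop, tendsto_map'_iff]
  exact ((tendsto_qPoch q hq).inv₀ (qPochInf_self_ne_zero hq)).congr fun n =>
    (qPochRecip_natCast q n).symm

theorem tendsto_qPochRecip_natCast_add {q : ℂ} (hq : ‖q‖ < 1) (r : ℤ) :
    Tendsto (fun N : ℕ => qPochRecip q (N + r)) atTop (𝓝 (qPochInf q q)⁻¹) :=
  (tendsto_qPochRecip hq).comp
    (tendsto_atTop_add_const_right _ r tendsto_natCast_atTop_atTop)

theorem exists_norm_qPochRecip_le {q : ℂ} (hq : ‖q‖ < 1) :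
    ∃ K : ℝ, ∀ n, ‖qPochRecip q n‖ ≤ K := by
  have h := tendsto_qPochRecip_natCast_add hq 0
  obtain ⟨K, hK⟩ := (Metric.isBounded_range_of_tendsto _ h).exists_norm_le
  refine ⟨K, fun n => ?_⟩
  rcases lt_or_ge n 0 with hn | hn
  · rw [qPochRecip_of_neg q hn, norm_zero]
    exact (norm_nonneg _).trans (hK _ ⟨0, rfl⟩)
  · lift n to ℕ using hn
    exact hK _ ⟨n, by simp⟩

/-! ### Convergence of theta series -/

theorem Int.add_one_mul_self_ediv_two (j : ℤ) : (j + 1) * (j + 1 - 1) / 2 = j * (j - 1) / 2 + j := by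
  rw [← Int.add_mul_ediv_right _ _ two_ne_zero]
  ring_nf

theorem theta_term_succ {Q z : ℂ} (hQ : Q ≠ 0) (hz : z ≠ 0) (j : ℤ) :
    Q ^ ((j + 1) * (j + 1 - 1) / 2) * z ^ (j + 1)
      = z * Q ^ j * (Q ^ (j * (j - 1) / 2) * z ^ j) := by
  rw [Int.add_one_mul_self_ediv_two, zpow_add₀ hQ, zpow_add_one₀ hz]
  ring

theorem summable_theta {Q z : ℂ} (hQ : Q ≠ 0) (hQ1 : ‖Q‖ < 1) (hz : z ≠ 0) :
    Summable fun j : ℤ => Q ^ (j * (j - 1) / 2) * z ^ j := by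
  have hne : ∀ j : ℤ, Q ^ (j * (j - 1) / 2) * z ^ j ≠ 0 := fun j =>
    mul_ne_zero (zpow_ne_zero _ hQ) (zpow_ne_zero _ hz)
  have hpow := tendsto_pow_atTop_nhds_zero_of_lt_one (norm_nonneg Q) hQ1
  refine Summable.of_nat_of_neg ?_ ?_
  · refine summable_of_ratio_test_tendsto_lt_one (l := 0) one_pos
      (Eventually.of_forall fun n => hne n) ?_
    refine (by simpa using hpow.const_mul ‖z‖ :
      Tendsto (fun n : ℕ => ‖z‖ * ‖Q‖ ^ n) atTop (𝓝 0)).congr fun n => ?_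
    rw [Nat.cast_succ, theta_term_succ hQ hz, norm_mul, mul_div_cancel_right₀ _
      (norm_ne_zero_iff.mpr (hne n)), norm_mul, zpow_natCast, norm_pow]
  · refine summable_of_ratio_test_tendsto_lt_one (l := 0) one_pos
      (Eventually.of_forall fun n => hne _) ?_
    refine (by simpa using (hpow.comp (tendsto_add_atTop_nat 1)).const_mul ‖z‖⁻¹ :
      Tendsto (fun n : ℕ => ‖z‖⁻¹ * ‖Q‖ ^ (n + 1)) atTop (𝓝 0)).congr fun n => ?_
    have h := theta_term_succ hQ hz (-(n : ℤ) - 1)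
    rw [show -(n : ℤ) - 1 + 1 = -n by ring] at h
    rw [h, Nat.cast_succ, neg_add', norm_mul (z * _), div_mul_cancel_right₀
      (norm_ne_zero_iff.mpr (hne _)), norm_mul z, norm_zpow, ← zpow_natCast,
      show -(n : ℤ) - 1 = -((n + 1 : ℕ) : ℤ) by push_cast; ring, zpow_neg, mul_inv, inv_inv]

/-- A theta series with `Q = q²`, `z = q^{r+1}`, since `k(k+r) = k(k-1) + (r+1)k`. -/
theorem summable_zpow_mul_add {q : ℂ} (h0 : q ≠ 0) (hq : ‖q‖ < 1) (r : ℤ) :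
    Summable fun k : ℤ => q ^ (k * (k + r)) := by
  refine (summable_theta (pow_ne_zero 2 h0) (by simpa using pow_lt_one₀ (norm_nonneg q) hq two_ne_zero)
    (zpow_ne_zero (r + 1) h0)).congr fun k => ?_
  rw [← zpow_natCast, ← zpow_mul, ← zpow_mul, ← zpow_add₀ h0]
  congr 1
  have := Int.mul_ediv_cancel' (Int.even_mul_pred_self k).two_dvd
  push_cast
  linear_combination this

/-! ### Durfee rectangles -/

/-- A form of the `q`-Chu–Vandermonde summation. -/
theorem hasSum_qVandermonde {q : ℂ} (h0 : q ≠ 0) (hq : ‖q‖ < 1) (N : ℕ) (r : ℤ) :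
    HasSum (fun k : ℤ => q ^ (k * (k + r)) * qPochRecip q k * qPochRecip q (k + r)
      * qPochRecip q (N - k)) (qPochRecip q N * qPochRecip q (N + r)) := by
  induction N generalizing r with
  | zero =>
    convert hasSum_single (0 : ℤ) ?_ using 1
    · simp [qPochRecip_zero]
    · intro k hk
      rcases lt_or_gt_of_ne hk with hk | hk
      · simp [qPochRecip_of_neg q hk]
      · rw [qPochRecip_of_neg q (n := ((0 : ℕ) : ℤ) - k) (by push_cast; omega), mul_zero]
  | succ N ih =>
    have hN : (1 : ℂ) - q ^ ((N : ℤ) + 1) ≠ 0 := fun h => by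
      have h1 := qPochRecip_add_one_mul hq N
      rw [h, zero_mul, qPochRecip_natCast] at h1
      exact inv_ne_zero (qPoch_self_ne_zero hq N) h1.symm
    have h2 := (Equiv.subRight (1 : ℤ)).hasSum_iff.mpr (ih (r + 1))
    -- Pascal-type recurrence from `1 - q^{N+1} = (1 - q^{N+1-k}) + q^{N+1-k}(1 - q^k)`; the second
    -- part is the summand for `r + 1` at `k - 1`.
    have h3 := ((ih r).add (h2.mul_left (q ^ (N + r + 1)))).mul_left
      (1 - q ^ ((N : ℤ) + 1))⁻¹
    refine h3.of_eq (fun k => ?_) ?_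
    · rw [eq_inv_mul_iff_mul_eq₀ hN]
      simp only [Function.comp_apply, Equiv.subRight_apply]
      have e1 := qPochRecip_sub_one hq k
      have e2 := qPochRecip_sub_one hq (((N + 1 : ℕ) : ℤ) - k)
      have e3 : ((N + 1 : ℕ) : ℤ) - k - 1 = N - k := by push_cast; ring
      rw [e3] at e2
      rw [show k - 1 + (r + 1) = k + r by ring,
        show (N : ℤ) - (k - 1) = ((N + 1 : ℕ) : ℤ) - k by push_cast; ring, e1, e2]
      have e4 : q ^ ((N : ℤ) + r + 1) * q ^ ((k - 1) * (k + r))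
          = q ^ (k * (k + r)) * q ^ (((N + 1 : ℕ) : ℤ) - k) := by
        rw [← zpow_add₀ h0, ← zpow_add₀ h0]
        congr 1
        push_cast
        ring
      have e5 : q ^ ((N : ℤ) + 1) = q ^ (((N + 1 : ℕ) : ℤ) - k) * q ^ k := by
        rw [← zpow_add₀ h0]
        congr 1
        push_cast
        ring
      rw [e5]
      linear_combination (-(1 - q ^ k) * qPochRecip q k * qPochRecip q (k + r)
        * qPochRecip q (((N + 1 : ℕ) : ℤ) - k)) * e4
    · rw [eq_inv_mul_iff_mul_eq₀ hN]
      have e1 := qPochRecip_add_one_mul hq (N : ℤ)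
      have e2 := qPochRecip_add_one_mul hq (N + r)
      rw [show ((N + 1 : ℕ) : ℤ) = (N : ℤ) + 1 by push_cast; ring, ← mul_assoc, e1,
        show (N : ℤ) + 1 + r = N + r + 1 by ring, show (N : ℤ) + (r + 1) = N + r + 1 by ring,
        ← e2]
      ring

/-- The Durfee rectangle identity. -/
theorem hasSum_durfee {q : ℂ} (h0 : q ≠ 0) (hq : ‖q‖ < 1) (r : ℤ) :
    HasSum (fun k : ℤ => q ^ (k * (k + r)) * qPochRecip q k * qPochRecip q (k + r))
      (qPochInf q q)⁻¹ := by
  obtain ⟨K, hK⟩ := exists_norm_qPochRecip_le hq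
  have hK0 : 0 ≤ K := (norm_nonneg _).trans (hK 0)
  have hs := (summable_zpow_mul_add h0 hq r).norm.mul_right (K * K)
  have hb : ∀ k : ℤ, ‖q ^ (k * (k + r)) * qPochRecip q k * qPochRecip q (k + r)‖
      ≤ ‖q ^ (k * (k + r))‖ * (K * K) := fun k => by
    rw [mul_assoc, norm_mul, norm_mul]
    have := hK k
    have := hK (k + r)
    gcongr
  have hsum := Summable.of_norm_bounded hs hb
  have hlim : Tendsto (fun N : ℕ => ∑' k : ℤ, q ^ (k * (k + r)) * qPochRecip q k
      * qPochRecip q (k + r) * qPochRecip q (N - k)) atTop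
      (𝓝 (∑' k : ℤ, q ^ (k * (k + r)) * qPochRecip q k * qPochRecip q (k + r)
        * (qPochInf q q)⁻¹)) := by
    refine tendsto_tsum_of_dominated_convergence (hs.mul_right K) (fun k => ?_)
      (Eventually.of_forall fun N k => ?_)
    · simpa [sub_eq_add_neg] using (tendsto_qPochRecip_natCast_add hq (-k)).const_mul
        (q ^ (k * (k + r)) * qPochRecip q k * qPochRecip q (k + r))
    · rw [norm_mul]
      exact mul_le_mul (hb k) (hK _) (norm_nonneg _) (by positivity)
  simp only [(hasSum_qVandermonde h0 hq _ r).tsum_eq] at hlim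
  have hlim' := (tendsto_qPochRecip_natCast_add hq 0).mul (tendsto_qPochRecip_natCast_add hq r)
  simp only [add_zero] at hlim'
  have h := tendsto_nhds_unique hlim hlim'
  rw [tsum_mul_right] at h
  rw [← mul_right_cancel₀ (inv_ne_zero (qPochInf_self_ne_zero hq)) h]
  exact hsum.hasSum

/-! ### Jacobi triple product -/

/-- The finite form of the Jacobi triple product identity. -/
theorem hasSum_finite_triple_product {Q z w : ℂ} (hQ : Q ≠ 0) (hQ1 : ‖Q‖ < 1) (hzw : z * w = Q)
    (N : ℕ) :
    HasSum (fun j : ℤ => (-1) ^ j * (Q ^ (j * (j - 1) / 2) * z ^ j)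
      * qPochRecip Q (N - j) * qPochRecip Q (N + j))
      (qPoch z Q N * qPoch w Q N * qPochRecip Q (2 * N)) := by
  have hz : z ≠ 0 := left_ne_zero_of_mul (hzw.trans_ne hQ)
  induction N with
  | zero =>
    convert hasSum_single (0 : ℤ) ?_ using 1
    · simp [qPochRecip_zero, qPoch]
    · intro k hk
      rcases lt_or_gt_of_ne hk with hk | hk
      · simp [qPochRecip_of_neg Q hk]
      · rw [qPochRecip_of_neg Q (n := ((0 : ℕ) : ℤ) - k) (by push_cast; omega), mul_zero, zero_mul]
  | succ N ih =>
    set P := qPoch z Q N * qPoch w Q N * qPochRecip Q (2 * N)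
    have hne : ∀ n : ℕ, (1 : ℂ) - Q ^ ((n : ℤ) + 1) ≠ 0 := fun n h => by
      have h1 := qPochRecip_add_one_mul hQ1 n
      rw [h, zero_mul, qPochRecip_natCast] at h1
      exact inv_ne_zero (qPoch_self_ne_zero hQ1 n) h1.symm
    have hn1 := hne (2 * N)
    have hn2 := hne (2 * N + 1)
    have hm := (Equiv.subRight (1 : ℤ)).hasSum_iff.mpr ih
    have hp := (Equiv.addRight (1 : ℤ)).hasSum_iff.mpr ih
    -- Since `zw = Q`, the new factor is `(1 - zQ^N)(1 - wQ^N) = 1 + Q^{2N+1} - zQ^N - wQ^N`; its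
    -- last two terms shift `j` by one in either direction.
    have h := (((ih.mul_left (1 + Q ^ (2 * (N : ℤ) + 1))).sub (hm.mul_left (z * Q ^ (N : ℤ)))).sub
      (hp.mul_left (w * Q ^ (N : ℤ)))).mul_left
      ((1 - Q ^ (((2 * N : ℕ) : ℤ) + 1)) * (1 - Q ^ (((2 * N + 1 : ℕ) : ℤ) + 1)))⁻¹
    refine h.of_eq (fun j => ?_) ?_
    · rw [eq_inv_mul_iff_mul_eq₀ (mul_ne_zero hn1 hn2)]
      simp only [Function.comp_apply, Equiv.subRight_apply, Equiv.coe_addRight]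
      set T : ℤ → ℂ := fun j => (-1) ^ j * (Q ^ (j * (j - 1) / 2) * z ^ j) with hT
      have hTs : ∀ j, T (j + 1) = -(z * Q ^ j) * T j := fun j => by
        simp only [hT]
        rw [theta_term_succ hQ hz, zpow_add_one₀ (by norm_num)]
        ring
      change _ * (T j * _ * _) = (_ * (T j * _ * _) - _ * (T (j - 1) * _ * _)) - _ * (T (j + 1) * _ * _)
      obtain ⟨a, ha⟩ : ∃ a : ℤ, a = N - j := ⟨_, rfl⟩
      obtain ⟨b, hb⟩ : ∃ b : ℤ, b = N + j := ⟨_, rfl⟩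
      have t1 : w * Q ^ (N : ℤ) * T (j + 1) = -Q ^ (b + 1) * T j := by
        rw [hTs, hb, add_right_comm, zpow_add₀ hQ, zpow_add_one₀ hQ, ← hzw]
        ring
      have t2 : z * Q ^ (N : ℤ) * T (j - 1) = -Q ^ (a + 1) * T j := by
        have := hTs (j - 1)
        rw [sub_add_cancel] at this
        rw [this, ha, show (N : ℤ) = (N - j + 1) + (j - 1) by ring, zpow_add₀ hQ]
        ring_nf
      have i1 : (N : ℤ) - (j - 1) = a + 1 := by omega
      have i2 : (N : ℤ) + (j - 1) = b - 1 := by omega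
      have i3 : (N : ℤ) - (j + 1) = a - 1 := by omega
      have i4 : (N : ℤ) + (j + 1) = b + 1 := by omega
      have i5 : ((N + 1 : ℕ) : ℤ) - j = a + 1 := by omega
      have i6 : ((N + 1 : ℕ) : ℤ) + j = b + 1 := by omega
      rw [i1, i2, i3, i4, i5, i6, ← ha, ← hb,
        show ((2 * N : ℕ) : ℤ) + 1 = a + b + 1 by omega,
        show ((2 * N + 1 : ℕ) : ℤ) + 1 = a + b + 1 + 1 by omega,
        show 2 * (N : ℤ) + 1 = a + b + 1 by omega, qPochRecip_sub_one hQ1 a,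
        qPochRecip_sub_one hQ1 b, ← qPochRecip_add_one_mul hQ1 a, ← qPochRecip_add_one_mul hQ1 b]
      simp only [zpow_add_one₀ hQ, zpow_add₀ hQ a b] at t1 t2 ⊢
      linear_combination (exp := 1)
        qPochRecip Q (a + 1) * ((1 - Q ^ b) * ((1 - Q ^ b * Q) * qPochRecip Q (b + 1))) * t2
        + ((1 - Q ^ a) * ((1 - Q ^ a * Q) * qPochRecip Q (a + 1))) * qPochRecip Q (b + 1) * t1
    · rw [eq_inv_mul_iff_mul_eq₀ (mul_ne_zero hn1 hn2), ← sub_mul, ← sub_mul, qPoch_succ, qPoch_succ]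
      have e1 := qPochRecip_add_one_mul hQ1 ((2 * N : ℕ) : ℤ)
      have e2 := qPochRecip_add_one_mul hQ1 ((2 * N + 1 : ℕ) : ℤ)
      rw [show 2 * ((N + 1 : ℕ) : ℤ) = ((2 * N + 1 : ℕ) : ℤ) + 1 by push_cast; ring]
      have e3 : P = qPoch z Q N * qPoch w Q N * ((1 - Q ^ (((2 * N : ℕ) : ℤ) + 1))
          * ((1 - Q ^ (((2 * N + 1 : ℕ) : ℤ) + 1)) * qPochRecip Q (((2 * N + 1 : ℕ) : ℤ) + 1))) := by
        rw [e2, show ((2 * N + 1 : ℕ) : ℤ) = ((2 * N : ℕ) : ℤ) + 1 by push_cast; ring, e1]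
        simp [P]
      have e4 : Q ^ (2 * (N : ℤ) + 1) = z * Q ^ N * (w * Q ^ N) := by
        rw [zpow_add_one₀ hQ, two_mul, zpow_add₀ hQ, zpow_natCast]
        linear_combination (-Q ^ N * Q ^ N) * hzw
      rw [e3, e4, zpow_natCast]
      ring

/-- The Jacobi triple product identity. -/
theorem hasSum_triple_product {Q z w : ℂ} (hQ : Q ≠ 0) (hQ1 : ‖Q‖ < 1) (hzw : z * w = Q) :
    HasSum (fun j : ℤ => (-1) ^ j * (Q ^ (j * (j - 1) / 2) * z ^ j))
      (qPochInf z Q * qPochInf w Q * qPochInf Q Q) := by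
  have hz : z ≠ 0 := left_ne_zero_of_mul (hzw.trans_ne hQ)
  obtain ⟨K, hK⟩ := exists_norm_qPochRecip_le hQ1
  have hK0 : 0 ≤ K := (norm_nonneg _).trans (hK 0)
  have hs : Summable (fun j : ℤ => ‖(-1) ^ j * (Q ^ (j * (j - 1) / 2) * z ^ j)‖) := by
    simpa using (summable_theta hQ hQ1 hz).norm
  have hlim : Tendsto (fun N : ℕ => ∑' j : ℤ, (-1) ^ j * (Q ^ (j * (j - 1) / 2) * z ^ j)
      * qPochRecip Q (N - j) * qPochRecip Q (N + j)) atTop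
      (𝓝 (∑' j : ℤ, (-1) ^ j * (Q ^ (j * (j - 1) / 2) * z ^ j)
        * (qPochInf Q Q)⁻¹ * (qPochInf Q Q)⁻¹)) := by
    refine tendsto_tsum_of_dominated_convergence ((hs.mul_right K).mul_right K) (fun j => ?_)
      (Eventually.of_forall fun N j => ?_)
    · have h1 := tendsto_qPochRecip_natCast_add hQ1 (-j)
      simp only [← sub_eq_add_neg] at h1
      exact (h1.const_mul _).mul (tendsto_qPochRecip_natCast_add hQ1 j)
    · rw [norm_mul, norm_mul]
      have := hK (N - j)
      have := hK (N + j)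
      gcongr
  simp only [(hasSum_finite_triple_product hQ hQ1 hzw _).tsum_eq] at hlim
  have h2N : Tendsto (fun N : ℕ => qPochRecip Q (2 * N)) atTop (𝓝 (qPochInf Q Q)⁻¹) :=
    (tendsto_qPochRecip hQ1).comp
      (tendsto_natCast_atTop_atTop.const_mul_atTop' (by norm_num : (0 : ℤ) < 2))
  -- The limit reads `S/(Q)_∞² = (z)_∞ (w)_∞/(Q)_∞`; one factor `1/(Q)_∞` cancels.
  have h := tendsto_nhds_unique hlim
    (((tendsto_qPoch z hQ1).mul (tendsto_qPoch w hQ1)).mul h2N)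
  rw [tsum_mul_right, tsum_mul_right] at h
  have hinv := inv_ne_zero (qPochInf_self_ne_zero hQ1)
  rw [← mul_right_cancel₀ hinv h, mul_assoc, inv_mul_cancel₀ (qPochInf_self_ne_zero hQ1), mul_one]
  exact hs.of_norm.hasSum

/-! ### The double series -/

theorem qPoch_inv_mul_qBinom {q : ℂ} (hq : ‖q‖ < 1) (N : ℕ) (k : ℤ) :
    (qPoch q q N)⁻¹ * qBinom q N k = qPochRecip q k * qPochRecip q (N - k) := by
  have hN := qPoch_self_ne_zero hq N
  by_cases hk : 0 ≤ k ∧ k ≤ N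
  · lift k to ℕ using hk.1
    obtain ⟨d, rfl⟩ := Nat.exists_eq_add_of_le (Int.ofNat_le.mp hk.2)
    rw [show ((k + d : ℕ) : ℤ) - k = d by push_cast; ring, qPochRecip_natCast, qPochRecip_natCast,
      qBinom, if_pos hk, Int.toNat_natCast, Nat.add_sub_cancel_left, mul_div_assoc', inv_mul_cancel₀ hN,
      one_div, mul_inv]
  · rw [qBinom, if_neg hk, mul_zero]
    rcases not_and_or.mp hk with h | h
    · rw [qPochRecip_of_neg q (not_le.mp h), zero_mul]
    · rw [qPochRecip_of_neg q (n := N - k) (by omega), mul_zero]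

theorem mul_five_mul_add_three_ediv_two (m : ℤ) :
    m * (5 * m + 3) / 2 = 5 * (m * (m - 1) / 2) + 4 * m := by
  have := Int.mul_ediv_cancel' (Int.even_mul_pred_self m).two_dvd
  refine Int.ediv_eq_of_eq_mul_right two_ne_zero ?_
  linear_combination -5 * this

theorem zpow_double_exponent {q : ℂ} (h0 : q ≠ 0) (n m : ℤ) :
    q ^ (n * (n + 1) + m * (5 * m + 3) / 2)
      = q ^ (n * (n + 1)) * ((q ^ 5) ^ (m * (m - 1) / 2) * (q ^ 4) ^ m) := by
  rw [mul_five_mul_add_three_ediv_two, ← zpow_natCast, ← zpow_natCast, ← zpow_mul, ← zpow_mul,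
    ← zpow_add₀ h0, ← zpow_add₀ h0]
  rfl

/-- The reciprocals are uniformly bounded, so a product of theta series in `n` and in `m` dominates.
-/
theorem summable_double_series {q : ℂ} (h0 : q ≠ 0) (hq : ‖q‖ < 1) :
    Summable fun p : ℤ × ℤ => (-1 : ℂ) ^ p.2 * q ^ (p.1 * (p.1 + 1) + p.2 * (5 * p.2 + 3) / 2)
      * (qPochRecip q (p.1 - 2 * p.2) * qPochRecip q (p.1 + 1 + 2 * p.2)) := by
  obtain ⟨K, hK⟩ := exists_norm_qPochRecip_le hq
  have hK0 : 0 ≤ K := (norm_nonneg _).trans (hK 0)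
  have h5 : ‖q ^ 5‖ < 1 := by simpa using pow_lt_one₀ (norm_nonneg q) hq (n := 5) (by norm_num)
  have hs := ((summable_zpow_mul_add h0 hq 1).norm.mul_of_nonneg
    (summable_theta (pow_ne_zero 5 h0) h5 (pow_ne_zero 4 h0)).norm
    (fun _ => norm_nonneg _) (fun _ => norm_nonneg _)).mul_right (K * K)
  refine Summable.of_norm_bounded hs fun p => ?_
  rw [zpow_double_exponent h0, norm_mul, norm_mul, norm_mul (q ^ _), norm_mul (qPochRecip _ _),
    norm_zpow, norm_neg, norm_one, one_zpow, one_mul]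
  have := hK (p.1 - 2 * p.2)
  have := hK (p.1 + 1 + 2 * p.2)
  gcongr

theorem hasSum_double_series_left {q : ℂ} (h0 : q ≠ 0) (hq : ‖q‖ < 1) (m : ℤ) :
    HasSum (fun n : ℤ => (-1 : ℂ) ^ m * q ^ (n * (n + 1) + m * (5 * m + 3) / 2)
      * (qPochRecip q (n - 2 * m) * qPochRecip q (n + 1 + 2 * m)))
      ((-1) ^ m * ((q ^ 13) ^ (m * (m - 1) / 2) * (q ^ 10) ^ m) * (qPochInf q q)⁻¹) := by
  have h := ((Equiv.subRight (2 * m)).hasSum_iff.mpr (hasSum_durfee h0 hq (4 * m + 1))).mul_left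
    ((-1) ^ m * ((q ^ 13) ^ (m * (m - 1) / 2) * (q ^ 10) ^ m))
  refine h.of_eq (fun n => ?_) rfl
  simp only [Function.comp_apply, Equiv.subRight_apply]
  have e : q ^ (n * (n + 1) + m * (5 * m + 3) / 2) = (q ^ 13) ^ (m * (m - 1) / 2) * (q ^ 10) ^ m
      * q ^ ((n - 2 * m) * (n - 2 * m + (4 * m + 1))) := by
    rw [mul_five_mul_add_three_ediv_two, ← zpow_natCast, ← zpow_natCast, ← zpow_mul, ← zpow_mul,
      ← zpow_add₀ h0, ← zpow_add₀ h0]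
    congr 1
    have := Int.mul_ediv_cancel' (Int.even_mul_pred_self m).two_dvd
    push_cast
    linear_combination -4 * this
  rw [e, show n - 2 * m + (4 * m + 1) = n + 1 + 2 * m by ring]
  ring

theorem hasSum_double_series {q : ℂ} (h0 : q ≠ 0) (hq : ‖q‖ < 1) :
    HasSum (fun p : ℤ × ℤ => (-1 : ℂ) ^ p.2 * q ^ (p.1 * (p.1 + 1) + p.2 * (5 * p.2 + 3) / 2)
      * (qPochRecip q (p.1 - 2 * p.2) * qPochRecip q (p.1 + 1 + 2 * p.2)))
      (qPochInf (q ^ 3) (q ^ 13) * qPochInf (q ^ 10) (q ^ 13) * qPochInf (q ^ 13) (q ^ 13)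
        / qPochInf q q) := by
  have hS := (summable_double_series h0 hq).hasSum
  have hS' := ((Equiv.prodComm ℤ ℤ).hasSum_iff.mpr hS).prod_fiberwise
    (hasSum_double_series_left h0 hq)
  have h13 : ‖q ^ 13‖ < 1 := by simpa using pow_lt_one₀ (norm_nonneg q) hq (n := 13) (by norm_num)
  have hJ := (hasSum_triple_product (pow_ne_zero 13 h0) h13
    (show q ^ 10 * q ^ 3 = q ^ 13 by ring)).mul_right (qPochInf q q)⁻¹
  rw [hS'.unique hJ, ← div_eq_mul_inv, mul_comm (qPochInf (q ^ 10) _)] at hS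
  exact hS

/-- The stated range of `m` is exactly where both indices `n - 2m` and `n + 1 + 2m` are nonnegative.
-/
theorem hasSum_double_series_right (q : ℂ) (n : ℤ) :
    HasSum (fun m : ℤ => (-1 : ℂ) ^ m * q ^ (n * (n + 1) + m * (5 * m + 3) / 2)
      * (qPochRecip q (n - 2 * m) * qPochRecip q (n + 1 + 2 * m)))
      (∑ m ∈ Finset.Icc (-((n + 1) / 2)) (n / 2),
        (-1 : ℂ) ^ m * q ^ (n * (n + 1) + m * (5 * m + 3) / 2)
          * (qPochRecip q (n - 2 * m) * qPochRecip q (n + 1 + 2 * m))) := by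
  refine hasSum_sum_of_ne_finset_zero fun m hm => ?_
  rw [Finset.mem_Icc, not_and_or] at hm
  rcases hm with hm | hm
  · rw [qPochRecip_of_neg q (n := n + 1 + 2 * m) (by omega), mul_zero, mul_zero]
  · rw [qPochRecip_of_neg q (n := n - 2 * m) (by omega), zero_mul, mul_zero]

theorem hasSum_series_of_ne_zero {q : ℂ} (h0 : q ≠ 0) (hq : ‖q‖ < 1) :
    HasSum
      (fun n : ℕ =>
        ∑ m ∈ Finset.Icc (-(((n : ℤ) + 1) / 2)) ((n : ℤ) / 2),
          (-1 : ℂ) ^ m * q ^ ((n : ℤ) * (n + 1) + m * (5 * m + 3) / 2)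
            * (qPochRecip q (n - 2 * m) * qPochRecip q (n + 1 + 2 * m)))
      (qPochInf (q ^ 3) (q ^ 13) * qPochInf (q ^ 10) (q ^ 13) * qPochInf (q ^ 13) (q ^ 13)
        / qPochInf q q) := by
  have h := (hasSum_double_series h0 hq).prod_fiberwise (hasSum_double_series_right q)
  have hneg : ∀ n ∉ Set.range ((↑) : ℕ → ℤ), ∑ m ∈ Finset.Icc (-((n + 1) / 2)) (n / 2),
      (-1 : ℂ) ^ m * q ^ (n * (n + 1) + m * (5 * m + 3) / 2)
        * (qPochRecip q (n - 2 * m) * qPochRecip q (n + 1 + 2 * m)) = 0 := fun n hn => by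
    have hn0 : n < 0 := by
      by_contra hn0
      exact hn ⟨n.toNat, Int.toNat_of_nonneg (not_lt.mp hn0)⟩
    refine Finset.sum_eq_zero fun m _ => ?_
    -- The two indices add up to `2n + 1 < 0`, so one of them is negative.
    rcases lt_or_ge (n - 2 * m) 0 with hm | hm
    · rw [qPochRecip_of_neg q hm, zero_mul, mul_zero]
    · rw [qPochRecip_of_neg q (n := n + 1 + 2 * m) (by omega), mul_zero, mul_zero]
  exact (Function.Injective.hasSum_iff Nat.cast_injective hneg).mpr h

theorem qPochInf_zero_left (q : ℂ) : qPochInf 0 q = 1 := by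
  simp [qPochInf]

theorem double_exponent_pos {n : ℕ} (hn : n ≠ 0) (m : ℤ) :
    0 < (n : ℤ) * (n + 1) + m * (5 * m + 3) / 2 := by
  have h1 : 0 < (n : ℤ) * (n + 1) := by positivity
  have h2 : 0 ≤ m * (5 * m + 3) := by
    rcases lt_or_ge m 0 with hm | hm
    · exact mul_nonneg_of_nonpos_of_nonpos hm.le (by omega)
    · positivity
  omega

theorem mainTheorem7 (q : ℂ) (hq : ‖q‖ < 1) :
    HasSum
      (fun n : ℕ =>
        ∑ m ∈ Finset.Icc (-(((n : ℤ) + 1) / 2)) ((n : ℤ) / 2),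
          (-1 : ℂ) ^ m * q ^ ((n : ℤ) * (n + 1) + m * (5 * m + 3) / 2)
            / qPoch q q (2 * n + 1) * qBinom q (2 * n + 1) ((n : ℤ) - 2 * m))
      (qPochInf (q ^ 3) (q ^ 13) * qPochInf (q ^ 10) (q ^ 13) * qPochInf (q ^ 13) (q ^ 13)
        / qPochInf q q) := by
  rcases eq_or_ne q 0 with rfl | h0
  -- At `q = 0` exponent laws for integer powers fail, but every exponent with `n ≠ 0` is positive,
  -- leaving only `n = m = 0`.
  · refine (hasSum_single 0 fun n hn => ?_).of_eq (fun _ => rfl) ?_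
    · refine Finset.sum_eq_zero fun m _ => ?_
      rw [zero_zpow _ (double_exponent_pos hn m).ne', mul_zero, zero_div, zero_mul]
    · simp [qPochInf_zero_left, qPoch, qBinom]
  · refine (hasSum_series_of_ne_zero h0 hq).of_eq (fun n => Finset.sum_congr rfl fun m _ => ?_) rfl
    rw [div_mul_eq_mul_div, mul_div_assoc, div_eq_inv_mul, qPoch_inv_mul_qBinom hq,
      show ((2 * n + 1 : ℕ) : ℤ) - (n - 2 * m) = n + 1 + 2 * m by push_cast; ring]
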